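/- **Proposition.** Let $\kappa(x,y,z)=x^2+y^2+z^2-xyz-2$ and let $\Gamma$ be the group of polynomial automorphisms of $\mathbb{C}^3$ that preserve $\kappa$. Let $\pi=\langle X,Y\rangle$ be the free group of rank two, and identify $\mathbb{C}^3$ with the space of characters $[\rho]=(\operatorname{tr}\rho(X),\operatorname{tr}\rho(Y),\operatorname{tr}\rho(XY))$ of representations $\rho:\pi\to \mathrm{SL}(2,\mathbb{C})$. Let $\Gamma_{(2)}\subset\Gamma$ be the kernel of the composition $\Gamma\to \mathrm{PGL}(2,\mathbb{Z})\to \mathrm{GL}(2,\mathbb{Z}/2)\cong\mathfrak{S}_3$; that is, $\gamma\in\Gamma$ belongs to $\Gamma_{(2)}$ if and only if there are an automorphism $\varphi$ of $\pi$ acting trivially on $H_1(\pi;\mathbb{Z}/2)$ and a homomorphism $\zeta:\pi\to\{\pm1\}$ such that $\gamma[\rho]=[\zeta\cdot(\rho\circ\varphi^{-1})]$ for all $\rho$. Let $$\Omega_0=(-\infty,-2)\times(-\infty,-2)\times(-\infty,-2)\subset\mathbb{R}^3\subset\mathbb{C}^3,\qquad \Omega=\Gamma\cdot\Omega_0 .$$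 Then: 1. $\Gamma$ preserves $\mathbb{R}^3$, and $\Omega$ is a $\Gamma$-invariant open subset of $\mathbb{R}^3$. 2. $\Omega$ is the disjoint union $\coprod_{\gamma\in\Gamma_{(2)}}\gamma\Omega_0$; that is, $\Omega=\bigcup_{\gamma\in\Gamma_{(2)}}\gamma\Omega_0$, and $\gamma\Omega_0\cap\delta\Omega_0=\emptyset$ for distinct $\gamma,\delta\in\Gamma_{(2)}$. 3. $\Gamma_{(2)}$ has index $6$ in $\Gamma$. The connected components of $\Omega$ are exactly the sets $\gamma\Omega_0$ with $\gamma\in\Gamma_{(2)}$, and $\Gamma_{(2)}$ permutes them freely: if $\gamma\in\Gamma_{(2)}$ and $\gamma C=C$ for some component $C$, then $\gamma=1$. 4. If $\gamma\in\Gamma_{(2)}$ maps some point of $\Omega_0$ into $\Omega_0$, then $\gamma=1$. -/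

import Mathlib

noncomputable section

namespace Fricke

/-- Affine space `ℂ³`, the `SL(2,ℂ)`-character variety of the free group of rank two. -/
abbrev C3 : Type := Fin 3 → ℂ

/-- The polynomial `κ(x,y,z) = x² + y² + z² - xyz - 2`, as a function on `ℂ³`. -/
def kappa (p : C3) : ℂ :=
  p 0 ^ 2 + p 1 ^ 2 + p 2 ^ 2 - p 0 * p 1 * p 2 - 2

/-- A self-map of `ℂ³` whose three coordinates are polynomials. -/
def IsPolynomialMap (f : C3 → C3) : Prop :=
  ∃ P : Fin 3 → MvPolynomial (Fin 3) ℂ, ∀ p i, f p i = MvPolynomial.eval p (P i)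

theorem isPolynomialMap_id : IsPolynomialMap id :=
  ⟨fun i => MvPolynomial.X i, fun p i => by simp⟩

theorem IsPolynomialMap.comp {f g : C3 → C3} (hf : IsPolynomialMap f)
    (hg : IsPolynomialMap g) : IsPolynomialMap (f ∘ g) := by
  obtain ⟨P, hP⟩ := hf
  obtain ⟨Q, hQ⟩ := hg
  refine ⟨fun i => MvPolynomial.bind₁ Q (P i), fun p i => ?_⟩
  have h : g p = fun j => MvPolynomial.eval p (Q j) := funext (hQ p)
  rw [Function.comp_apply, hP, h]
  exact (MvPolynomial.eval₂Hom_bind₁ (RingHom.id ℂ) p Q (P i)).symm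

/-- `Γ`: the group of polynomial automorphisms of `ℂ³` which preserve `κ`. -/
def Gamma : Subgroup (Equiv.Perm C3) where
  carrier := {γ | IsPolynomialMap γ ∧ IsPolynomialMap γ.symm ∧ ∀ p, kappa (γ p) = kappa p}
  one_mem' := ⟨isPolynomialMap_id, isPolynomialMap_id, fun _ => rfl⟩
  mul_mem' := by
    rintro a b ⟨ha, ha', hka⟩ ⟨hb, hb', hkb⟩
    exact ⟨ha.comp hb, hb'.comp ha', fun p => (hka (b p)).trans (hkb p)⟩
  inv_mem' := by
    rintro a ⟨ha, ha', hka⟩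
    refine ⟨ha', ha, fun p => ?_⟩
    have h := hka (a.symm p)
    rw [Equiv.apply_symm_apply] at h
    exact h.symm

/-- The free group `π` of rank two. -/
abbrev Pi2 : Type := FreeGroup (Fin 2)

/-- The free generator `X` of `π`. -/
def genX : Pi2 := FreeGroup.of 0

/-- The free generator `Y` of `π`. -/
def genY : Pi2 := FreeGroup.of 1

/-- The group `SL(2,ℂ)`. -/
abbrev SL2C : Type := Matrix.SpecialLinearGroup (Fin 2) ℂ

/-- The character `(tr ρ(X), tr ρ(Y), tr ρ(XY))` of a representation `ρ : π → SL(2,ℂ)`. -/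
def character (ρ : Pi2 →* SL2C) : C3 :=
  ![(ρ genX).val.trace, (ρ genY).val.trace, (ρ (genX * genY)).val.trace]

/-- Multiplication of a representation by a homomorphism of `π` into the center `{±1}` of
`SL(2,ℂ)`. On characters these are the sign-changes. -/
def twist (ζ : Pi2 →* Subgroup.center SL2C) (ρ : Pi2 →* SL2C) : Pi2 →* SL2C where
  toFun g := (ζ g : SL2C) * ρ g
  map_one' := by simp
  map_mul' a b := by
    have h : ρ a * (ζ b : SL2C) = (ζ b : SL2C) * ρ a :=
      Subgroup.mem_center_iff.mp (ζ b).2 (ρ a)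
    simp only [map_mul, Subgroup.coe_mul]
    calc (ζ a : SL2C) * (ζ b : SL2C) * (ρ a * ρ b)
        = (ζ a : SL2C) * ((ζ b : SL2C) * ρ a) * ρ b := by group
      _ = (ζ a : SL2C) * (ρ a * (ζ b : SL2C)) * ρ b := by rw [h]
      _ = (ζ a : SL2C) * ρ a * ((ζ b : SL2C) * ρ b) := by group

/-- The abelianization `π → ℤ²`, sending a word to its exponent sums in `X` and `Y`. -/
def abelianize : Pi2 →* Multiplicative (Fin 2 → ℤ) :=
  FreeGroup.lift fun j => Multiplicative.ofAdd (Pi.single j 1)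

/-- The matrix of the action of `φ` on `H₁(π;ℤ) = ℤ²`: its columns are the classes of
`φ(X)` and `φ(Y)`. -/
def homologyMatrix (φ : MulAut Pi2) : Matrix (Fin 2) (Fin 2) ℤ :=
  Matrix.of fun i j => (abelianize (φ (FreeGroup.of j))).toAdd i

theorem abelianize_apply (φ : MulAut Pi2) (w : Pi2) :
    (abelianize (φ w)).toAdd = (homologyMatrix φ).mulVec (abelianize w).toAdd := by
  have h : abelianize.comp φ.toMonoidHom =
      (AddMonoidHom.toMultiplicative (homologyMatrix φ).mulVecLin.toAddMonoidHom).comp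
        abelianize := by
    apply FreeGroup.ext_hom
    intro j
    apply Multiplicative.toAdd.injective
    ext i
    simp [abelianize, homologyMatrix]
  exact congrArg Multiplicative.toAdd (DFunLike.congr_fun h w)

theorem homologyMatrix_one : homologyMatrix 1 = 1 := by
  ext i j
  simp [homologyMatrix, abelianize, Matrix.one_apply, Pi.single_apply]

theorem homologyMatrix_mul (φ ψ : MulAut Pi2) :
    homologyMatrix (φ * ψ) = homologyMatrix φ * homologyMatrix ψ := by
  ext i j
  exact congrFun (abelianize_apply φ (ψ (FreeGroup.of j))) i

/-- The homomorphism `h : Aut(π) → GL(2,ℤ)` given by the action on homology. -/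
def homologyRep : MulAut Pi2 →* Matrix.GeneralLinearGroup (Fin 2) ℤ :=
  MonoidHom.toHomUnits
    { toFun := homologyMatrix
      map_one' := homologyMatrix_one
      map_mul' := homologyMatrix_mul }

/-- Reduction modulo two `GL(2,ℤ) → GL(2,ℤ/2)`. -/
def reduceModTwo :
    Matrix.GeneralLinearGroup (Fin 2) ℤ →* Matrix.GeneralLinearGroup (Fin 2) (ZMod 2) :=
  Matrix.GeneralLinearGroup.map (Int.castRingHom (ZMod 2))

/-- `γ` is induced by the automorphism `φ` of `π` up to a sign-change: for some
`ζ : π → {±1}` one has `γ[ρ] = [ζ · (ρ ∘ φ⁻¹)]` for all `ρ`. The projection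
`Γ → PGL(2,ℤ) = GL(2,ℤ)/{±1}` sends such a `γ` to the class of `h(φ)`. -/
def IsInducedBy (γ : Equiv.Perm C3) (φ : MulAut Pi2) : Prop :=
  ∃ ζ : Pi2 →* Subgroup.center SL2C, ∀ ρ : Pi2 →* SL2C,
    γ (character ρ) = character (twist ζ (ρ.comp (φ⁻¹).toMonoidHom))

theorem isInducedBy_one : IsInducedBy 1 1 := by
  refine ⟨1, fun ρ => ?_⟩
  have h : twist 1 (ρ.comp (1⁻¹ : MulAut Pi2).toMonoidHom) = ρ := by
    ext1 g
    simp [twist]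
  rw [h]
  rfl

theorem IsInducedBy.mul {γ δ : Equiv.Perm C3} {φ ψ : MulAut Pi2} (hγ : IsInducedBy γ φ)
    (hδ : IsInducedBy δ ψ) : IsInducedBy (γ * δ) (φ * ψ) := by
  obtain ⟨ζ, hζ⟩ := hγ
  obtain ⟨ξ, hξ⟩ := hδ
  refine ⟨FreeGroup.lift fun i => ζ (FreeGroup.of i) * ξ (φ⁻¹ (FreeGroup.of i)), fun ρ => ?_⟩
  rw [Equiv.Perm.mul_apply, hξ, hζ]
  congr 1
  ext1 g
  simp [twist, mul_assoc]

theorem IsInducedBy.inv {γ : Equiv.Perm C3} {φ : MulAut Pi2} (hγ : IsInducedBy γ φ) :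
    IsInducedBy γ⁻¹ φ⁻¹ := by
  obtain ⟨ζ, hζ⟩ := hγ
  let ξ : Pi2 →* Subgroup.center SL2C := FreeGroup.lift fun i => (ζ (FreeGroup.of i))⁻¹
  refine ⟨ξ.comp φ.toMonoidHom, fun ρ => ?_⟩
  rw [Equiv.Perm.inv_eq_iff_eq, hζ]
  congr 1
  ext1 g
  simp [twist, ξ]

/-- `Γ₍₂₎`: the kernel of `Γ → PGL(2,ℤ) → GL(2,ℤ/2) ≅ 𝔖₃`, that is, the elements of `Γ`
lying over automorphisms of `π` which act trivially on `H₁(π;ℤ/2)`. -/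
def Gamma2 : Subgroup (Equiv.Perm C3) where
  carrier := {γ | γ ∈ Gamma ∧ ∃ φ : MulAut Pi2, IsInducedBy γ φ ∧
    reduceModTwo (homologyRep φ) = 1}
  one_mem' := ⟨Gamma.one_mem, 1, isInducedBy_one, by simp⟩
  mul_mem' := by
    rintro a b ⟨ha, φ, hφ, hφ'⟩ ⟨hb, ψ, hψ, hψ'⟩
    exact ⟨Gamma.mul_mem ha hb, φ * ψ, hφ.mul hψ, by simp [hφ', hψ']⟩
  inv_mem' := by
    rintro a ⟨ha, φ, hφ, hφ'⟩
    exact ⟨Gamma.inv_mem ha, φ⁻¹, hφ.inv, by simp [hφ']⟩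

/-- The inclusion `ℝ³ ⊂ ℂ³`. -/
def ofReal3 (p : Fin 3 → ℝ) : C3 := fun i => (p i : ℂ)

/-- The set `ℝ³` of real points of `ℂ³`. -/
def realPoints : Set C3 := Set.range ofReal3

/-- The octant `Ω₀ = (-∞,-2) × (-∞,-2) × (-∞,-2)` in `ℝ³`. -/
def Omega0 : Set C3 := ofReal3 '' {p | ∀ i, p i < -2}

/-- `Ω = Γ · Ω₀`. -/
def Omega : Set C3 := ⋃ γ ∈ Gamma, γ '' Omega0

/-- The set of connected components of a subset `S` of `ℂ³`. -/
def components (S : Set C3) : Set (Set C3) := {C | ∃ p ∈ S, C = connectedComponentIn S p}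

end Fricke

end

/-! The group `Γ` is generated by Vieta involutions, sign changes of product one and coordinate
permutations. This is a degree descent. If the coordinates of an automorphism have maximal degree at
least two, the relation `κ(P) = κ(X)` makes one Vieta involution lower that degree
(`totalDegree_vieta_lt`). An affine map preserving `κ` is a signed permutation, because `xyz`
factors uniquely into linear forms. Vieta involutions and sign changes lie in `Γ₍₂₎`. A nontrivial
permutation does not, since it moves the vanishing traces of suitable diagonal representations. So
`Γ₍₂₎` consists of the reduced Vieta words times sign changes, and the copy of `𝔖₃` is a complement
to it, of order 6. Freeness is ping-pong on real points with all `|x_i| > 2`. A nonempty reduced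
word sends a point with negative product `xyz` to one with positive product
(`exists_mem_dominantRegion`), hence never from `Ω₀` to `Ω₀`; a sign change preserving negativity of
all three coordinates is trivial. The translates of `Ω₀` are thus disjoint, and being connected and
open in `ℝ³` they are the components. -/

noncomputable section

namespace Fricke

open MvPolynomial

/-! ### Generators of `Γ` and reduced words -/

/-- The Vieta involution `x_k ↦ x_{k+1} x_{k+2} - x_k` of `ℂ³`. -/
def vieta (k : Fin 3) : Equiv.Perm C3 :=
  Function.Involutive.toPerm (fun p => Function.update p k (p (k + 1) * p (k + 2) - p k)) (by
    intro p
    ext i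
    fin_cases k <;> fin_cases i <;> simp)

theorem vieta_apply (k : Fin 3) (p : C3) :
    vieta k p = Function.update p k (p (k + 1) * p (k + 2) - p k) := rfl

theorem vieta_mul_self (k : Fin 3) : vieta k * vieta k = 1 :=
  Equiv.ext ((vieta k).left_inv)

theorem vieta_mem_Gamma (k : Fin 3) : vieta k ∈ Gamma := by
  have h : IsPolynomialMap (vieta k) := by
    refine ⟨Function.update X k (X (k + 1) * X (k + 2) - X k), fun p i => ?_⟩
    rw [vieta_apply]
    rcases eq_or_ne i k with rfl | hi <;> simp [*]
  refine ⟨h, h, fun p => ?_⟩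
  fin_cases k <;> simp [vieta_apply, kappa] <;> ring

/-- The permutation of the coordinates of `ℂ³` given by `σ`. -/
def permCoords : Equiv.Perm (Fin 3) →* Equiv.Perm C3 where
  toFun σ := Equiv.arrowCongr σ (Equiv.refl ℂ)
  map_one' := rfl
  map_mul' _ _ := rfl

theorem permCoords_apply (σ : Equiv.Perm (Fin 3)) (p : C3) (i : Fin 3) :
    permCoords σ p i = p (σ.symm i) := rfl

theorem permCoords_injective : Function.Injective permCoords := by
  intro σ τ h
  apply Equiv.symm_bijective.injective
  ext1 i
  have := congrFun (DFunLike.congr_fun h (Pi.single (σ.symm i) 1)) i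
  simp only [permCoords_apply, Pi.single_eq_same] at this
  by_contra hne
  rw [Pi.single_eq_of_ne (Ne.symm hne)] at this
  exact one_ne_zero this

theorem permCoords_mem_Gamma (σ : Equiv.Perm (Fin 3)) : permCoords σ ∈ Gamma := by
  have h : ∀ τ, IsPolynomialMap (permCoords τ) := fun τ =>
    ⟨fun i => X (τ.symm i), fun p i => by simp [permCoords_apply]⟩
  refine ⟨h σ, h σ⁻¹, fun p => ?_⟩
  have h1 := Equiv.sum_comp σ.symm fun i => p i ^ 2
  have h2 := Equiv.prod_comp σ.symm p
  simp only [Fin.sum_univ_three, Fin.prod_univ_three] at h1 h2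
  simp only [kappa, permCoords_apply]
  linear_combination h1 - h2

/-- `s` multiplies the coordinates by signs whose product is one. -/
def IsSignChange (s : Equiv.Perm C3) : Prop :=
  ∃ ε : Fin 3 → ℂ, (∀ i, ε i ^ 2 = 1) ∧ ε 0 * ε 1 * ε 2 = 1 ∧ ∀ p i, s p i = ε i * p i

/-- The sign change with the given signs. -/
def signChange (ε : Fin 3 → ℂ) (h : ∀ i, ε i ^ 2 = 1) : Equiv.Perm C3 :=
  Function.Involutive.toPerm (fun p i => ε i * p i) (by
    intro p
    ext i
    linear_combination p i * h i)

theorem IsSignChange.mul_self {s : Equiv.Perm C3} (hs : IsSignChange s) : s * s = 1 := by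
  obtain ⟨ε, h, -, hs⟩ := hs
  ext p i
  simp only [Equiv.Perm.mul_apply, hs, Equiv.Perm.one_apply]
  linear_combination p i * h i

theorem IsSignChange.mem_Gamma {s : Equiv.Perm C3} (hs : IsSignChange s) : s ∈ Gamma := by
  have hinv : s.symm = s := inv_eq_of_mul_eq_one_left hs.mul_self
  obtain ⟨ε, h, h', hs⟩ := hs
  have hp : IsPolynomialMap s := ⟨fun i => C (ε i) * X i, fun p i => by simp [hs]⟩
  refine ⟨hp, hinv ▸ hp, fun p => ?_⟩
  simp only [kappa, hs]
  linear_combination p 0 ^ 2 * h 0 + p 1 ^ 2 * h 1 + p 2 ^ 2 * h 2 - p 0 * p 1 * p 2 * h'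

/-- The products of a reduced word in the Vieta involutions and a sign change. -/
def IsReducedWord (γ : Equiv.Perm C3) : Prop :=
  ∃ (l : List (Fin 3)) (s : Equiv.Perm C3), l.IsChain (· ≠ ·) ∧ IsSignChange s ∧
    γ = (l.map vieta).prod * s

theorem IsSignChange.isReducedWord {s : Equiv.Perm C3} (hs : IsSignChange s) :
    IsReducedWord s :=
  ⟨[], s, by simp, hs, by simp⟩

/-- The descent composes only on the left, so this closure suffices and no sign change has to be
moved past a Vieta involution. -/
theorem IsReducedWord.vieta_mul {γ : Equiv.Perm C3} (h : IsReducedWord γ) (k : Fin 3) :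
    IsReducedWord (vieta k * γ) := by
  obtain ⟨l, s, hl, hs, rfl⟩ := h
  match l, hl with
  | [], _ => exact ⟨[k], s, by simp, hs, by simp⟩
  | j :: l, hl =>
    by_cases hjk : k = j
    · subst hjk
      refine ⟨l, s, hl.tail, hs, ?_⟩
      simp [← mul_assoc, vieta_mul_self]
    · exact ⟨k :: j :: l, s, List.isChain_cons_cons.2 ⟨hjk, hl⟩, hs, by simp [mul_assoc]⟩

theorem IsReducedWord.mem_of_vieta_of_sign {γ : Equiv.Perm C3} (h : IsReducedWord γ)
    (H : Subgroup (Equiv.Perm C3)) (hv : ∀ k, vieta k ∈ H) (hs : ∀ s, IsSignChange s → s ∈ H) :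
    γ ∈ H := by
  obtain ⟨l, s, -, hs', rfl⟩ := h
  refine H.mul_mem (H.list_prod_mem ?_) (hs s hs')
  simp only [List.mem_map]
  rintro _ ⟨k, -, rfl⟩
  exact hv k

/-! ### Degree descent in `Γ` -/

theorem eq_affine_of_totalDegree_le_one {P : MvPolynomial (Fin 3) ℂ} (h : P.totalDegree ≤ 1) :
    P = C (coeff 0 P) + ∑ j, C (coeff (Finsupp.single j 1) P) * X j := by
  ext d
  simp only [coeff_add, coeff_C, coeff_sum, coeff_C_mul, coeff_X]
  rcases eq_or_ne d 0 with rfl | hd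
  · simp
  by_cases hd1 : ∃ j, Finsupp.single j 1 = d
  · obtain ⟨j, rfl⟩ := hd1
    simp [Finsupp.single_left_inj, hd.symm]
  · push Not at hd1
    rw [if_neg hd.symm, Finset.sum_eq_zero fun j _ => by simp [hd1 j], add_zero]
    apply coeff_eq_zero_of_totalDegree_lt
    obtain ⟨j, hj⟩ := Finsupp.ne_iff.1 hd
    simp only [Finsupp.coe_zero, Pi.zero_apply] at hj
    refine h.trans_lt ?_
    by_contra hlt
    have hdeg : d.degree ≤ 1 := not_lt.1 hlt
    have h1 : Finsupp.single j 1 ≤ d := Finsupp.single_le_iff.2 (Nat.one_le_iff_ne_zero.2 hj)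
    obtain ⟨e, rfl⟩ := exists_add_of_le h1
    have he : e.degree = 0 := by
      simp only [map_add, Finsupp.degree_single] at hdeg
      omega
    rw [Finsupp.degree_eq_zero_iff] at he
    exact hd1 j (by simp [he])

/-- The polynomial `κ(P₀,P₁,P₂)`. -/
def kappaPoly (P : Fin 3 → MvPolynomial (Fin 3) ℂ) : MvPolynomial (Fin 3) ℂ :=
  P 0 ^ 2 + P 1 ^ 2 + P 2 ^ 2 - P 0 * P 1 * P 2 - 2

theorem kappaPoly_eq (P : Fin 3 → MvPolynomial (Fin 3) ℂ) (k : Fin 3) :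
    kappaPoly P =
      P k ^ 2 + P (k + 1) ^ 2 + P (k + 2) ^ 2 - P k * (P (k + 1) * P (k + 2)) - 2 := by
  fin_cases k <;> simp [kappaPoly] <;> ring

theorem totalDegree_kappaPoly_X : (kappaPoly X).totalDegree ≤ 3 := by
  have hX : ∀ i, (X i : MvPolynomial (Fin 3) ℂ).totalDegree = 1 := fun i => totalDegree_X i
  have h2 : ∀ i, ((X i : MvPolynomial (Fin 3) ℂ) ^ 2).totalDegree ≤ 3 := fun i =>
    (totalDegree_pow _ _).trans (by simp)
  have h3 : ((X 0 * X 1 * X 2 : MvPolynomial (Fin 3) ℂ)).totalDegree ≤ 3 :=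
    (totalDegree_mul _ _).trans (by
      have := totalDegree_mul (X 0 : MvPolynomial (Fin 3) ℂ) (X 1)
      rw [hX, hX] at this
      rw [hX]
      omega)
  have h4 : (2 : MvPolynomial (Fin 3) ℂ).totalDegree ≤ 3 := by
    rw [show (2 : MvPolynomial (Fin 3) ℂ) = C 2 from (map_ofNat C 2).symm]
    simp
  unfold kappaPoly
  refine (totalDegree_sub _ _).trans (max_le ((totalDegree_sub _ _).trans (max_le ?_ h3)) h4)
  exact (totalDegree_add _ _).trans
    (max_le ((totalDegree_add _ _).trans (max_le (h2 0) (h2 1))) (h2 2))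

/-- `P k` and its replacement `R` are the two roots of a monic quadratic: their sum is `P (k+1) * P
(k+2)`, and their product has degree at most the maximum of 3 and twice the degrees of the other two
coordinates. If `deg R ≥ deg P k ≥ 2`, the product forces `deg R = deg P k`, equal to the larger of
the other two degrees; the sum then has too large a degree, since no coordinate is constant. -/
theorem totalDegree_vieta_lt {P : Fin 3 → MvPolynomial (Fin 3) ℂ}
    (hκ : kappaPoly P = kappaPoly X) (hpos : ∀ i, 1 ≤ (P i).totalDegree) (k : Fin 3)
    (hmax : ∀ i, (P i).totalDegree ≤ (P k).totalDegree) (hk : 2 ≤ (P k).totalDegree) :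
    (P (k + 1) * P (k + 2) - P k).totalDegree < (P k).totalDegree := by
  have hne : ∀ i, P i ≠ 0 := fun i h => by simpa [h] using hpos i
  have hmul : P k * (P (k + 1) * P (k + 2) - P k) =
      P (k + 1) ^ 2 + P (k + 2) ^ 2 - 2 - kappaPoly X := by
    rw [← hκ, kappaPoly_eq P k]
    ring
  have hsum : (P (k + 1) * P (k + 2) - P k) + P k = P (k + 1) * P (k + 2) := by ring
  generalize hR : P (k + 1) * P (k + 2) - P k = R at *
  rcases eq_or_ne R 0 with rfl | hR0
  · rw [totalDegree_zero]
    omega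
  have h1 := congrArg totalDegree hmul
  rw [totalDegree_mul_of_isDomain (hne k) hR0] at h1
  have h2 := congrArg totalDegree hsum
  rw [totalDegree_mul_of_isDomain (hne _) (hne _)] at h2
  have h3 := totalDegree_add R (P k)
  have h4 : (2 : MvPolynomial (Fin 3) ℂ).totalDegree = 0 := by
    rw [show (2 : MvPolynomial (Fin 3) ℂ) = C 2 from (map_ofNat C 2).symm]
    simp
  have h5 := totalDegree_sub (P (k + 1) ^ 2 + P (k + 2) ^ 2 - 2) (kappaPoly X)
  have h6 := totalDegree_sub (P (k + 1) ^ 2 + P (k + 2) ^ 2) 2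
  have h7 := totalDegree_add (P (k + 1) ^ 2) (P (k + 2) ^ 2)
  have h8 := totalDegree_pow (P (k + 1)) 2
  have h9 := totalDegree_pow (P (k + 2)) 2
  have h10 := totalDegree_kappaPoly_X
  have := hpos (k + 1)
  have := hpos (k + 2)
  have := hmax (k + 1)
  have := hmax (k + 2)
  omega

/-- A factorization of `x₀x₁x₂` into linear forms is the obvious one up to order and scalars. -/
theorem exists_perm_of_prod_linear {M : Fin 3 → Fin 3 → ℂ}
    (h : ∀ p : C3, ∏ i, ∑ j, M i j * p j = ∏ i, p i) :
    ∃ τ : Equiv.Perm (Fin 3), ∀ i j, i ≠ τ j → M i j = 0 := by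
  have hpoly : ∏ i, ∑ j, C (M i j) * X j = (∏ i, X i : MvPolynomial (Fin 3) ℂ) :=
    MvPolynomial.funext fun p => by simpa using h p
  -- The prime `X k` divides one of the linear forms; evaluation at the other basis vectors kills
  -- the remaining coefficients of that form.
  have hdvd : ∀ k, ∃ i, ∀ j, j ≠ k → M i j = 0 := by
    intro k
    have hk : (X k : MvPolynomial (Fin 3) ℂ) ∣ ∏ i, ∑ j, C (M i j) * X j :=
      hpoly ▸ Finset.dvd_prod_of_mem _ (Finset.mem_univ k)
    obtain ⟨i, -, hi⟩ := (X_prime.dvd_finsetProd_iff _).1 hk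
    refine ⟨i, fun j hj => ?_⟩
    have := map_dvd (eval (Pi.single j (1 : ℂ))) hi
    simpa [Pi.single_apply, hj.symm] using this
  choose τ hτ using hdvd
  have hinj : Function.Injective τ := by
    intro k k' hkk
    by_contra hne
    have hrow : ∀ j, M (τ k) j = 0 := fun j => by
      by_cases hj : j = k
      · rw [hkk]
        exact hτ k' j (hj ▸ hne)
      · exact hτ k j hj
    have h1 := h 1
    rw [Finset.prod_eq_zero (Finset.mem_univ (τ k)) (by simp [hrow])] at h1
    simp at h1
  refine ⟨Equiv.ofBijective τ (Finite.injective_iff_bijective.1 hinj), fun i j hij => ?_⟩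
  obtain ⟨k, rfl⟩ := (Finite.injective_iff_bijective.1 hinj).2 i
  exact hτ k j fun hjk => hij (by simp [hjk])

/-- An affine map preserving `κ` is the composition of a permutation of the coordinates and a
sign change. -/
theorem exists_sign_perm_of_affine {f : C3 → C3} {v : C3} {M : Fin 3 → Fin 3 → ℂ}
    (hf : ∀ p i, f p i = v i + ∑ j, M i j * p j) (hκ : ∀ p, kappa (f p) = kappa p) :
    ∃ (σ : Equiv.Perm (Fin 3)) (s : Equiv.Perm C3), IsSignChange s ∧ f = ⇑(s * permCoords σ) := by
  have hF : ∀ (p : C3) (t : ℂ), kappa (fun i => v i + t * ∑ j, M i j * p j) =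
      kappa (fun i => t * p i) := by
    intro p t
    refine Eq.trans (congrArg kappa ?_) (hκ fun i => t * p i)
    ext i
    rw [hf, Finset.mul_sum]
    simp only [mul_left_comm]
  -- The third difference in `t` at -1, 0, 1, 2 isolates the cubic part of `κ`.
  have hcub : ∀ p : C3, ∏ i, ∑ j, M i j * p j = ∏ i, p i := by
    intro p
    have h0 := hF p 0
    have h1 := hF p 1
    have h2 := hF p 2
    have h3 := hF p (-1)
    simp only [kappa] at h0 h1 h2 h3
    rw [Fin.prod_univ_three, Fin.prod_univ_three]
    linear_combination (-1 / 6) * (h2 - 3 * h1 + 3 * h0 - h3)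
  obtain ⟨τ, hτ⟩ := exists_perm_of_prod_linear hcub
  set ε : Fin 3 → ℂ := fun i => M i (τ.symm i) with hε
  have hL : ∀ (p : C3) i, ∑ j, M i j * p j = ε i * p (τ.symm i) := by
    intro p i
    refine Finset.sum_eq_single _ (fun j _ hj => ?_) (by simp)
    rw [hτ i j fun h => hj (by simp [h]), zero_mul]
  have hprod : ε 0 * ε 1 * ε 2 = 1 := by
    have := hcub 1
    rw [Fin.prod_univ_three, hL, hL, hL] at this
    simpa using this
  -- The second difference at -1, 0, 1 isolates the quadratic part; substituting `q ∘ τ` undoes the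
  -- permutation.
  have hquad : ∀ q : C3, (ε 0 * q 0) ^ 2 + (ε 1 * q 1) ^ 2 + (ε 2 * q 2) ^ 2
      - v 0 * (ε 1 * q 1) * (ε 2 * q 2) - v 1 * (ε 0 * q 0) * (ε 2 * q 2)
      - v 2 * (ε 0 * q 0) * (ε 1 * q 1) = q 0 ^ 2 + q 1 ^ 2 + q 2 ^ 2 := by
    intro q
    have h0 := hF (q ∘ τ) 0
    have h1 := hF (q ∘ τ) 1
    have h3 := hF (q ∘ τ) (-1)
    have h4 := Equiv.sum_comp τ fun i => q i ^ 2
    rw [Fin.sum_univ_three, Fin.sum_univ_three] at h4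
    simp only [kappa, hL, Function.comp_apply, Equiv.apply_symm_apply] at h0 h1 h3
    linear_combination (1 / 2) * (h1 + h3 - 2 * h0) + h4
  have hsq : ∀ i, ε i ^ 2 = 1 := by
    intro i
    have := hquad (Pi.single i 1)
    fin_cases i <;> simpa [Pi.single_apply] using this
  have hne : ∀ i, ε i ≠ 0 := fun i h => by simpa [h] using hsq i
  have hv : ∀ i, v i = 0 := by
    -- With the squares already matched, a vector with two ones leaves a single cross term, a
    -- nonzero multiple of one `v i`.
    have e0 := hquad ![0, 1, 1]
    have e1 := hquad ![1, 0, 1]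
    have e2 := hquad ![1, 1, 0]
    simp [hsq] at e0 e1 e2
    intro i
    fin_cases i
    · simpa [hne] using e0
    · simpa [hne] using e1
    · simpa [hne] using e2
  refine ⟨τ, signChange ε hsq, ⟨ε, hsq, hprod, fun _ _ => rfl⟩, ?_⟩
  ext p i
  rw [hf, hL, hv, zero_add]
  rfl

theorem exists_isReducedWord_mul_perm {γ : Equiv.Perm C3} (hγ : γ ∈ Gamma) :
    ∃ (h : Equiv.Perm C3) (σ : Equiv.Perm (Fin 3)), IsReducedWord h ∧ γ = h * permCoords σ := by
  obtain ⟨P, hP⟩ := hγ.1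
  induction hn : ∑ i, (P i).totalDegree using Nat.strong_induction_on generalizing γ P with
  | _ n ih =>
    have hκ : kappaPoly P = kappaPoly X := MvPolynomial.funext fun p => by
      have := hγ.2.2 p
      simpa [kappa, kappaPoly, hP] using this
    -- A constant coordinate would contradict surjectivity of `γ`.
    have hpos : ∀ i, 1 ≤ (P i).totalDegree := by
      intro i
      by_contra hi
      have hC := totalDegree_eq_zero_iff_eq_C.1 (Nat.lt_one_iff.1 (not_le.1 hi))
      have hconst : ∀ q : C3, q i = coeff 0 (P i) := fun q => by
        have := hP (γ.symm q) i
        rwa [hC, eval_C, Equiv.apply_symm_apply] at this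
      have h0 := hconst 0
      have h1 := hconst 1
      rw [← h0] at h1
      simp at h1
    obtain ⟨k, hmax⟩ := Finite.exists_max fun i => (P i).totalDegree
    by_cases hk : 2 ≤ (P k).totalDegree
    · have hlt := totalDegree_vieta_lt hκ hpos k hmax hk
      set P' := Function.update P k (P (k + 1) * P (k + 2) - P k) with hP'
      have hsum : ∑ i, (P' i).totalDegree < n := by
        rw [← hn]
        refine Finset.sum_lt_sum (fun i _ => ?_) ⟨k, Finset.mem_univ k, by simpa [hP'] using hlt⟩
        rcases eq_or_ne i k with rfl | hi
        · simpa [hP'] using hlt.le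
        · simp [hP', hi]
      obtain ⟨h, σ, hh, hγ'⟩ := ih _ hsum (Gamma.mul_mem (vieta_mem_Gamma k) hγ) P' (fun p i => by
        rw [Equiv.Perm.mul_apply, vieta_apply, hP']
        rcases eq_or_ne i k with rfl | hi
        · simp [hP]
        · simp [hP, hi]) rfl
      refine ⟨vieta k * h, σ, hh.vieta_mul k, ?_⟩
      rw [mul_assoc, ← hγ', ← mul_assoc, vieta_mul_self, one_mul]
    · have hle : ∀ i, (P i).totalDegree ≤ 1 := fun i => (hmax i).trans (by omega)
      obtain ⟨σ, s, hs, hf⟩ := exists_sign_perm_of_affine (f := γ) (v := fun i => coeff 0 (P i))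
        (M := fun i j => coeff (Finsupp.single j 1) (P i)) (fun p i => by
          rw [hP]
          conv_lhs => rw [eq_affine_of_totalDegree_le_one (hle i)]
          simp) hγ.2.2
      exact ⟨s, σ, hs.isReducedWord, DFunLike.coe_injective hf⟩

/-! ### Lifts of the generators to automorphisms of `π` -/

theorem reduceModTwo_homologyRep_eq_one_iff (φ : MulAut Pi2) :
    reduceModTwo (homologyRep φ) = 1 ↔
      ∀ i j, ((homologyMatrix φ i j : ℤ) : ZMod 2) = (1 : Matrix _ _ _) i j := by
  rw [Units.ext_iff, ← Matrix.ext_iff]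
  rfl

theorem twist_one (ρ : Pi2 →* SL2C) : twist 1 ρ = ρ := by
  ext1 g
  simp [twist]

/-- Cayley–Hamilton in `SL(2)`: `B + B⁻¹` is the scalar `tr B`. -/
theorem trace_mul_inv (A B : SL2C) :
    (A * B⁻¹).val.trace = A.val.trace * B.val.trace - (A * B).val.trace := by
  simp [Matrix.trace_fin_two, Matrix.mul_apply, Matrix.SpecialLinearGroup.coe_inv,
    Matrix.adjugate_fin_two]
  ring

theorem trace_mul_comm (A B : SL2C) : (A * B).val.trace = (B * A).val.trace :=
  Matrix.trace_mul_comm _ _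

theorem trace_mul_mul_self (A B : SL2C) :
    (A * B * B).val.trace = (A * B).val.trace * B.val.trace - A.val.trace := by
  have := trace_mul_inv (A * B) B
  rw [mul_inv_cancel_right] at this
  linear_combination this

theorem trace_self_mul_mul (A B : SL2C) :
    (A * (A * B)).val.trace = (A * B).val.trace * A.val.trace - B.val.trace := by
  have h1 := trace_mul_mul_self B A
  have h2 := trace_mul_comm (B * A) A
  have h3 := trace_mul_comm A B
  have h4 := trace_mul_comm (A * B) A
  rw [← mul_assoc] at h2
  linear_combination -h2 + h1 - A.val.trace * h3 - h4

theorem trace_inv (A : SL2C) : (A⁻¹).val.trace = A.val.trace := by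
  simp [Matrix.trace_fin_two, Matrix.SpecialLinearGroup.coe_inv, Matrix.adjugate_fin_two, add_comm]

/-- An endomorphism of `π` lifting the Vieta involution `vieta k`. -/
def vietaHom (k : Fin 3) : Pi2 →* Pi2 :=
  FreeGroup.lift (![![genX * genY * genY, genY⁻¹], ![genX⁻¹, genX * genX * genY],
    ![genX, genY⁻¹]] k)

theorem vietaHom_comp_self (k : Fin 3) : (vietaHom k).comp (vietaHom k) = MonoidHom.id _ := by
  apply FreeGroup.ext_hom
  intro j
  fin_cases k <;> fin_cases j <;> simp [vietaHom, genX, genY, mul_assoc]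

/-- The involutive automorphism of `π` lifting the Vieta involution `vieta k`. -/
def vietaAut (k : Fin 3) : MulAut Pi2 :=
  (vietaHom k).toMulEquiv (vietaHom k) (vietaHom_comp_self k) (vietaHom_comp_self k)

theorem vieta_isInducedBy (k : Fin 3) : IsInducedBy (vieta k) (vietaAut k) := by
  refine ⟨1, fun ρ => ?_⟩
  rw [twist_one]
  -- The lift is an involution, so `φ⁻¹` is given by the same endomorphism.
  change _ = character (ρ.comp (vietaHom k))
  have hX : genX = FreeGroup.of 0 := rfl
  have hY : genY = FreeGroup.of 1 := rfl
  ext i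
  rw [vieta_apply]
  fin_cases k <;> fin_cases i <;>
    simp [character, vietaHom, hX, hY, -Matrix.SpecialLinearGroup.coe_mul,
      -Matrix.SpecialLinearGroup.coe_inv, trace_inv, trace_mul_inv]
  · rw [trace_mul_mul_self]; ring
  · rw [mul_assoc]
    exact (trace_self_mul_mul _ _).symm
  · rw [mul_assoc, inv_mul_cancel_left]

theorem vieta_mem_Gamma2 (k : Fin 3) : vieta k ∈ Gamma2 := by
  refine ⟨vieta_mem_Gamma k, vietaAut k, vieta_isInducedBy k, ?_⟩
  rw [reduceModTwo_homologyRep_eq_one_iff]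
  intro i j
  fin_cases k <;> fin_cases i <;> fin_cases j <;>
    simp [homologyMatrix, abelianize] <;> rfl

/-- The central element `r` of `SL(2,ℂ)`, for a square root of unity `r`. -/
def centralOfSign (r : ℂ) (hr : r ^ 2 = 1) : Subgroup.center SL2C :=
  ⟨⟨Matrix.scalar (Fin 2) r, by simp [hr]⟩,
    Matrix.SpecialLinearGroup.mem_center_iff.2 ⟨r, by simpa using hr, rfl⟩⟩

theorem trace_twist {ζ : Pi2 →* Subgroup.center SL2C} {w : Pi2} {r : ℂ}
    (h : Matrix.scalar (Fin 2) r = (ζ w : SL2C).val) (ρ : Pi2 →* SL2C) :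
    (twist ζ ρ w).val.trace = r * (ρ w).val.trace := by
  change ((ζ w : SL2C).val * (ρ w).val).trace = _
  rw [← h, Matrix.scalar_apply, ← Matrix.smul_eq_diagonal_mul, Matrix.trace_smul, smul_eq_mul]

theorem trace_twist_eq_zero_iff (ζ : Pi2 →* Subgroup.center SL2C) (ρ : Pi2 →* SL2C) (w : Pi2) :
    (twist ζ ρ w).val.trace = 0 ↔ (ρ w).val.trace = 0 := by
  obtain ⟨r, hr, hr'⟩ := Matrix.SpecialLinearGroup.mem_center_iff.1 (ζ w).2
  have hr0 : r ≠ 0 := by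
    rintro rfl
    simp at hr
  rw [trace_twist hr' ρ, mul_eq_zero, or_iff_right hr0]

theorem IsSignChange.mem_Gamma2 {s : Equiv.Perm C3} (hs : IsSignChange s) : s ∈ Gamma2 := by
  refine ⟨hs.mem_Gamma, 1, ?_, by simp⟩
  obtain ⟨ε, h, h', hs⟩ := hs
  -- The sign at `XY` is determined by those at `X` and `Y`; this is the product-one condition.
  have h2 : ε 2 = ε 0 * ε 1 := by linear_combination ε 0 * ε 1 * h 2 - ε 2 * h'
  refine ⟨FreeGroup.lift ![centralOfSign (ε 0) (h 0), centralOfSign (ε 1) (h 1)], fun ρ => ?_⟩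
  set ζ : Pi2 →* Subgroup.center SL2C :=
    FreeGroup.lift ![centralOfSign (ε 0) (h 0), centralOfSign (ε 1) (h 1)] with hζ
  have hX : Matrix.scalar (Fin 2) (ε 0) = (ζ genX : SL2C).val := by
    rw [hζ, genX, FreeGroup.lift_apply_of]
    rfl
  have hY : Matrix.scalar (Fin 2) (ε 1) = (ζ genY : SL2C).val := by
    rw [hζ, genY, FreeGroup.lift_apply_of]
    rfl
  have hXY : Matrix.scalar (Fin 2) (ε 2) = (ζ (genX * genY) : SL2C).val := by
    rw [h2, map_mul, hX, hY, map_mul]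
    rfl
  ext i
  rw [hs]
  fin_cases i
  · exact (trace_twist hX ρ).symm
  · exact (trace_twist hY ρ).symm
  · exact (trace_twist hXY ρ).symm

/-! ### Detecting the action modulo two; the index of `Γ₍₂₎` -/

/-- The diagonal matrix with entries `i` and `-i`. -/
def diagI : SL2C := ⟨!![Complex.I, 0; 0, -Complex.I], by simp⟩

theorem diagI_sq_val : (diagI * diagI).val = -1 := by
  change !![Complex.I, 0; 0, -Complex.I] * !![Complex.I, 0; 0, -Complex.I] = _
  ext i j
  fin_cases i <;> fin_cases j <;> simp

theorem diagI_pow_four : diagI * diagI * (diagI * diagI) = 1 := by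
  apply Subtype.ext
  change (diagI * diagI).val * (diagI * diagI).val = 1
  rw [diagI_sq_val]
  simp

/-- Even powers are `±1` and odd powers are `±diagI`, which is traceless. -/
theorem trace_diagI_zpow_eq_zero_iff (n : ℤ) : (diagI ^ n).val.trace = 0 ↔ (n : ZMod 2) = 1 := by
  have hpow : diagI ^ (4 : ℤ) = 1 := by
    rw [← diagI_pow_four, show (4 : ℤ) = 1 + 1 + (1 + 1) from rfl]
    simp only [zpow_add, zpow_one]
  have hn : diagI ^ n = diagI ^ (n % 4) := by
    conv_lhs => rw [← Int.mul_ediv_add_emod n 4, zpow_add, zpow_mul, hpow, one_zpow, one_mul]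
  have hodd : (n : ZMod 2) = 1 ↔ n % 2 = 1 := by
    simpa using ZMod.intCast_eq_intCast_iff' n 1 2
  have h1 : (diagI ^ (1 : ℤ)).val.trace = 0 := by
    rw [zpow_one]
    simp [diagI]
  have h2 : (diagI ^ (2 : ℤ)).val = -1 := by
    rw [zpow_two]
    exact diagI_sq_val
  have h3 : (diagI ^ (3 : ℤ)).val.trace = 0 := by
    have h3' : diagI ^ (3 : ℤ) = diagI ^ (2 : ℤ) * diagI ^ (1 : ℤ) := by
      rw [← zpow_add]
      rfl
    have h3 : (diagI ^ (3 : ℤ)).val = (diagI ^ (2 : ℤ)).val * (diagI ^ (1 : ℤ)).val := by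
      rw [h3']
      rfl
    rw [h3, h2, neg_one_mul, Matrix.trace_neg, h1, neg_zero]
  rw [hn, hodd]
  obtain h | h | h | h : n % 4 = 0 ∨ n % 4 = 1 ∨ n % 4 = 2 ∨ n % 4 = 3 := by omega
  · have : ¬ n % 2 = 1 := by omega
    rw [h, zpow_zero]
    simp [this]
  · have : n % 2 = 1 := by omega
    simp only [h, h1, this]
  · have : ¬ n % 2 = 1 := by omega
    rw [h, h2]
    simp [this]
  · have : n % 2 = 1 := by omega
    simp only [h, h3, this]

/-- The representation `w ↦ diagI ^ (c · [w])`, where `[w]` is the homology class of `w`. -/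
def diagRep (c : Fin 2 → ℤ) : Pi2 →* SL2C where
  toFun w := diagI ^ (c ⬝ᵥ (abelianize w).toAdd)
  map_one' := by simp
  map_mul' a b := by simp [dotProduct_add, zpow_add]

/-- The zero pattern of the character of `diagRep c` is invariant under `Γ₍₂₎`. -/
theorem character_diagRep_eq_zero_iff {γ : Equiv.Perm C3} (hγ : γ ∈ Gamma2) (c : Fin 2 → ℤ)
    (i : Fin 3) : γ (character (diagRep c)) i = 0 ↔ character (diagRep c) i = 0 := by
  obtain ⟨-, φ, ⟨ζ, hζ⟩, hφ⟩ := hγ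
  have hφ' : reduceModTwo (homologyRep φ⁻¹) = 1 := by rw [map_inv, map_inv, hφ, inv_one]
  rw [reduceModTwo_homologyRep_eq_one_iff] at hφ'
  -- A central twist does not affect vanishing of a trace, and `φ⁻¹` preserves the parity of the
  -- exponent `c · [w]`.
  have key : ∀ w, (twist ζ ((diagRep c).comp (φ⁻¹).toMonoidHom) w).val.trace = 0 ↔
      (diagRep c w).val.trace = 0 := by
    intro w
    rw [trace_twist_eq_zero_iff]
    change (diagI ^ (c ⬝ᵥ (abelianize (φ⁻¹ w)).toAdd)).val.trace = 0 ↔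
      (diagI ^ (c ⬝ᵥ (abelianize w).toAdd)).val.trace = 0
    rw [trace_diagI_zpow_eq_zero_iff, trace_diagI_zpow_eq_zero_iff, abelianize_apply]
    simp [dotProduct, Matrix.mulVec, Fin.sum_univ_two, hφ']
  rw [hζ]
  fin_cases i <;> exact key _

/-- For `c = (0,1)` only coordinate 0 of the character is nonzero, and for `c = (1,0)` only
coordinate 1, so `σ` fixes both indices. -/
theorem eq_one_of_permCoords_mem_Gamma2 {σ : Equiv.Perm (Fin 3)} (h : permCoords σ ∈ Gamma2) :
    σ = 1 := by
  have hz : ∀ (c : Fin 2 → ℤ) i, character (diagRep c) i = 0 ↔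
      ((![c 0, c 1, c 0 + c 1] i : ℤ) : ZMod 2) = 1 := by
    intro c i
    fin_cases i <;> refine (trace_diagI_zpow_eq_zero_iff _).trans ?_ <;>
      simp [dotProduct, abelianize, genX, genY, Fin.sum_univ_two]
  have h0 := character_diagRep_eq_zero_iff h ![0, 1]
  have h1 := character_diagRep_eq_zero_iff h ![1, 0]
  simp only [permCoords_apply, hz] at h0 h1
  have key : ∀ τ : Equiv.Perm (Fin 3),
      (∀ i, ((![(0 : ℤ), 1, 1] (τ i) : ℤ) : ZMod 2) = 1 ↔ ((![(0 : ℤ), 1, 1] i : ℤ) : ZMod 2) = 1) →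
      (∀ i, ((![(1 : ℤ), 0, 1] (τ i) : ℤ) : ZMod 2) = 1 ↔ ((![(1 : ℤ), 0, 1] i : ℤ) : ZMod 2) = 1) →
      τ = 1 := by decide
  exact inv_eq_one.1 (key σ⁻¹ h0 h1)

theorem isReducedWord_of_mem_Gamma2 {γ : Equiv.Perm C3} (hγ : γ ∈ Gamma2) : IsReducedWord γ := by
  obtain ⟨h, σ, hh, rfl⟩ := exists_isReducedWord_mul_perm hγ.1
  have hh2 : h ∈ Gamma2 :=
    hh.mem_of_vieta_of_sign Gamma2 vieta_mem_Gamma2 fun s hs => hs.mem_Gamma2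
  have hσ := eq_one_of_permCoords_mem_Gamma2 ((Gamma2.mul_mem_cancel_left hh2).1 hγ)
  rwa [hσ, map_one, mul_one]

theorem IsReducedWord.mem_Gamma2 {γ : Equiv.Perm C3} (hγ : IsReducedWord γ) : γ ∈ Gamma2 :=
  hγ.mem_of_vieta_of_sign Gamma2 vieta_mem_Gamma2 fun _ hs => hs.mem_Gamma2

theorem Gamma2_le_Gamma : Gamma2 ≤ Gamma := fun _ h => h.1

theorem relIndex_Gamma2 : Gamma2.relIndex Gamma = 6 := by
  have hle : permCoords.range ≤ Gamma := by
    rintro _ ⟨σ, rfl⟩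
    exact permCoords_mem_Gamma σ
  have hc : Subgroup.IsComplement' (permCoords.range.subgroupOf Gamma)
      (Gamma2.subgroupOf Gamma) := by
    refine (Subgroup.isComplement'_of_disjoint_and_mul_eq_univ ?_ ?_).symm
    · rw [Subgroup.disjoint_def]
      rintro ⟨_, _⟩ h ⟨σ, rfl⟩
      obtain rfl := eq_one_of_permCoords_mem_Gamma2 h
      rfl
    · refine Set.eq_univ_of_forall fun ⟨γ, hγ⟩ => ?_
      obtain ⟨h, σ, hh, rfl⟩ := exists_isReducedWord_mul_perm hγ
      exact ⟨⟨h, hh.mem_Gamma2.1⟩, hh.mem_Gamma2, ⟨permCoords σ, permCoords_mem_Gamma σ⟩,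
        ⟨σ, rfl⟩, rfl⟩
  rw [Subgroup.relIndex, hc.index_eq_card]
  rw [Nat.card_congr (Subgroup.subgroupOfEquivOfLe hle).toEquiv,
    ← Nat.card_congr (permCoords.ofInjective permCoords_injective).toEquiv]
  simp [Nat.card_eq_fintype_card, Fintype.card_perm, Nat.factorial]

/-! ### Action on real points -/

theorem ofReal3_injective : Function.Injective ofReal3 := fun p q h => by
  ext i
  exact Complex.ofReal_injective (congrFun h i)

theorem vieta_ofReal3 (k : Fin 3) (q : Fin 3 → ℝ) :
    vieta k (ofReal3 q) = ofReal3 (Function.update q k (q (k + 1) * q (k + 2) - q k)) := by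
  ext i
  rw [vieta_apply]
  rcases eq_or_ne i k with rfl | hi
  · simp [ofReal3]
  · simp [ofReal3, hi]

theorem IsSignChange.ofReal3 {s : Equiv.Perm C3} (hs : IsSignChange s) :
    ∃ e : Fin 3 → ℝ, (∀ i, e i = 1 ∨ e i = -1) ∧ e 0 * e 1 * e 2 = 1 ∧
      ∀ q, s (ofReal3 q) = Fricke.ofReal3 (e * q) := by
  obtain ⟨ε, h, h', hs⟩ := hs
  have he : ∀ i, ∃ e : ℝ, (e = 1 ∨ e = -1) ∧ ε i = e := fun i => by
    rcases sq_eq_sq_iff_eq_or_eq_neg.1 ((h i).trans (one_pow 2).symm) with hi | hi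
    · exact ⟨1, by simp, by simp [hi]⟩
    · exact ⟨-1, by simp, by simp [hi]⟩
  choose e he he' using he
  refine ⟨e, he, ?_, fun q => ?_⟩
  · simp only [he'] at h'
    exact_mod_cast h'
  · ext i
    simp [hs, he', Fricke.ofReal3]

theorem image_realPoints {γ : Equiv.Perm C3} (hγ : γ ∈ Gamma) :
    γ '' realPoints = realPoints := by
  have key : ∀ δ ∈ Gamma, δ '' realPoints ⊆ realPoints := by
    intro δ hδ
    obtain ⟨_, σ, ⟨l, s, -, hs, rfl⟩, rfl⟩ := exists_isReducedWord_mul_perm hδ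
    rintro _ ⟨_, ⟨q, rfl⟩, rfl⟩
    obtain ⟨e, -, -, he⟩ := hs.ofReal3
    rw [Equiv.Perm.mul_apply, Equiv.Perm.mul_apply,
      show permCoords σ (ofReal3 q) = ofReal3 (q ∘ σ.symm) from rfl, he]
    generalize e * (q ∘ σ.symm) = q'
    clear hδ he
    induction l with
    | nil => exact ⟨q', rfl⟩
    | cons k l ih =>
      obtain ⟨r, hr⟩ := ih
      rw [List.map_cons, List.prod_cons, Equiv.Perm.mul_apply, ← hr, vieta_ofReal3]
      exact ⟨_, rfl⟩
  refine (key γ hγ).antisymm fun p hp => ⟨γ⁻¹ p, key _ (Gamma.inv_mem hγ) ⟨p, hp, rfl⟩, ?_⟩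
  simp

/-! ### Ping-pong -/

/-- Here `a` is the coordinate being replaced and `u` the product of the other two. Either
hypothesis gives `u - a` the sign of `u` and more than half its size; `|u| > 4` then keeps it beyond
2. -/
theorem vieta_estimate {a u : ℝ} (hu : 4 < |u|) (h : a * u < 0 ∨ 2 * |a| < |u|) :
    0 < (u - a) * u ∧ 2 < |u - a| ∧ |u| < 2 * |u - a| := by
  rcases lt_or_ge u 0 with hu0 | hu0
  · rw [abs_of_neg hu0] at *
    have ha : 2 * (u - a) < u := by
      rcases h with h | h
      · linarith [pos_of_mul_neg_left h hu0.le]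
      · linarith [neg_abs_le a]
    have hneg : u - a < 0 := by linarith
    rw [abs_of_neg hneg]
    exact ⟨mul_pos_of_neg_of_neg hneg hu0, by linarith, by linarith⟩
  · rw [abs_of_nonneg hu0] at *
    have ha : u < 2 * (u - a) := by
      rcases h with h | h
      · linarith [neg_of_mul_neg_left h hu0]
      · linarith [le_abs_self a]
    have hpos : 0 < u - a := by linarith
    rw [abs_of_pos hpos]
    exact ⟨mul_pos hpos (by linarith), by linarith, by linarith⟩

/-- The region of `ℝ³` in which the `k`-th coordinate dominates. -/
def dominantRegion (k : Fin 3) : Set (Fin 3 → ℝ) :=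
  {q | (∀ i, 2 < |q i|) ∧ 0 < q k * (q (k + 1) * q (k + 2)) ∧ |q (k + 1) * q (k + 2)| < 2 * |q k|}

theorem prod_eq_rotate (q : Fin 3 → ℝ) (k : Fin 3) :
    q 0 * q 1 * q 2 = q k * (q (k + 1) * q (k + 2)) := by
  fin_cases k <;> simp <;> ring

/-- The negative-product alternative opens the ping-pong; the size alternative continues it from
another region. -/
theorem update_mem_dominantRegion {q : Fin 3 → ℝ} (hq : ∀ i, 2 < |q i|) (k : Fin 3)
    (h : q 0 * q 1 * q 2 < 0 ∨ 2 * |q k| < |q (k + 1) * q (k + 2)|) :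
    Function.update q k (q (k + 1) * q (k + 2) - q k) ∈ dominantRegion k := by
  rw [prod_eq_rotate q k] at h
  have hu : 4 < |q (k + 1) * q (k + 2)| := by
    rw [abs_mul]
    nlinarith [hq (k + 1), hq (k + 2)]
  obtain ⟨h1, h2, h3⟩ := vieta_estimate hu h
  have hk1 : k + 1 ≠ k := by simp
  have hk2 : k + 2 ≠ k := by simp
  refine ⟨fun i => ?_, ?_, ?_⟩
  · rcases eq_or_ne i k with rfl | hi
    · simpa using h2
    · simpa [hi] using hq i
  · simpa [hk1, hk2] using h1
  · simpa [hk1, hk2] using h3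

theorem two_mul_abs_lt_of_mem_dominantRegion {q : Fin 3 → ℝ} {j k : Fin 3} (hjk : k ≠ j)
    (hq : q ∈ dominantRegion j) : 2 * |q k| < |q (k + 1) * q (k + 2)| := by
  obtain ⟨h, -, h'⟩ := hq
  have key : ∀ a b c : ℝ, 2 < c → 0 < a → 0 < b → a * c < 2 * b → 2 * a < b * c := by
    intro a b c hc ha hb habc
    nlinarith
  have hpos : ∀ i, 0 < |q i| := fun i => by linarith [h i]
  rw [abs_mul] at *
  fin_cases j <;> fin_cases k <;> simp at hjk h' ⊢
  · rw [mul_comm |q _| |q _|]; exact key _ _ _ (h 2) (hpos 1) (hpos 0) h'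
  · exact key _ _ _ (h 1) (hpos 2) (hpos 0) (by linarith)
  · exact key _ _ _ (h 2) (hpos 0) (hpos 1) (by linarith)
  · rw [mul_comm |q _| |q _|]; exact key _ _ _ (h 0) (hpos 2) (hpos 1) (by linarith)
  · rw [mul_comm |q _| |q _|]; exact key _ _ _ (h 1) (hpos 0) (hpos 2) (by linarith)
  · exact key _ _ _ (h 0) (hpos 1) (hpos 2) (by linarith)

/-- Letters act from the right: the last one uses the negative product, and each earlier one differs
from the letter whose region has just been reached. -/
theorem exists_mem_dominantRegion {q : Fin 3 → ℝ} (hq : ∀ i, 2 < |q i|)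
    (hneg : q 0 * q 1 * q 2 < 0) (l : List (Fin 3)) (k : Fin 3)
    (hl : (k :: l).IsChain (· ≠ ·)) :
    ∃ r ∈ dominantRegion k, ((k :: l).map vieta).prod (ofReal3 q) = ofReal3 r := by
  induction l generalizing k with
  | nil =>
    exact ⟨_, update_mem_dominantRegion hq k (.inl hneg), by simp [vieta_ofReal3]⟩
  | cons j l ih =>
    obtain ⟨hkj, hl⟩ := List.isChain_cons_cons.1 hl
    obtain ⟨r, hr, hr'⟩ := ih j hl
    refine ⟨_, update_mem_dominantRegion hr.1 k
      (.inr (two_mul_abs_lt_of_mem_dominantRegion hkj hr)), ?_⟩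
    rw [List.map_cons, List.prod_cons, Equiv.Perm.mul_apply, hr', vieta_ofReal3]

theorem prod_neg_of_lt {q : Fin 3 → ℝ} (hq : ∀ i, q i < -2) : q 0 * q 1 * q 2 < 0 :=
  mul_neg_of_pos_of_neg (mul_pos_of_neg_of_neg (by linarith [hq 0]) (by linarith [hq 1]))
    (by linarith [hq 2])

theorem eq_one_of_mem_Omega0 {γ : Equiv.Perm C3} (hγ : γ ∈ Gamma2) {p : C3} (hp : p ∈ Omega0)
    (hγp : γ p ∈ Omega0) : γ = 1 := by
  obtain ⟨l, s, hl, hs, rfl⟩ := isReducedWord_of_mem_Gamma2 hγ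
  obtain ⟨q, hq, rfl⟩ := hp
  obtain ⟨q', hq', hqq'⟩ := hγp
  obtain ⟨e, he, he', hse⟩ := hs.ofReal3
  rw [Equiv.Perm.mul_apply, hse] at hqq'
  match l, hl with
  | [], _ =>
    have hqq' : q' = e * q := ofReal3_injective hqq'
    have he1 : ∀ i, e i = 1 := fun i => (he i).resolve_right fun hi => by
      have h1 := hq i
      have h2 := hq' i
      rw [hqq', Pi.mul_apply, hi] at h2
      linarith
    obtain ⟨ε, -, -, hs'⟩ := hs
    have hε : ∀ i, ε i = 1 := fun i => by
      -- The point `(1,1,1)` identifies the complex signs `ε` with the real signs `e`.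
      have h := congrFun (hse 1) i
      rw [hs'] at h
      simpa [ofReal3, he1] using h
    ext p i
    simp [hs', hε]
  | k :: l, hl =>
    exfalso
    have habs : ∀ i, 2 < |(e * q) i| := fun i => by
      have h1 : 2 < |q i| := lt_abs.2 (.inr (by linarith [hq i]))
      rcases he i with hi | hi <;> simpa [hi] using h1
    have hneg : (e * q) 0 * (e * q) 1 * (e * q) 2 < 0 := by
      have h1 : (e * q) 0 * (e * q) 1 * (e * q) 2 = q 0 * q 1 * q 2 := by
        simp only [Pi.mul_apply]
        linear_combination q 0 * q 1 * q 2 * he'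
      rw [h1]
      exact prod_neg_of_lt hq
    obtain ⟨r, ⟨-, hr, -⟩, hr'⟩ := exists_mem_dominantRegion habs hneg l k hl
    rw [hr'] at hqq'
    obtain rfl : q' = r := ofReal3_injective hqq'
    rw [← prod_eq_rotate] at hr
    exact hr.not_gt (prod_neg_of_lt hq')

/-! ### Translates of `Ω₀` and components of `Ω` -/

theorem disjoint_image_Omega0 {γ δ : Equiv.Perm C3} (hγ : γ ∈ Gamma2) (hδ : δ ∈ Gamma2)
    (hne : γ ≠ δ) : Disjoint (γ '' Omega0) (δ '' Omega0) := by
  rw [Set.disjoint_left]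
  rintro _ ⟨p, hp, rfl⟩ ⟨q, hq, hqp⟩
  apply hne
  have h := eq_one_of_mem_Omega0 (Gamma2.mul_mem (Gamma2.inv_mem hδ) hγ) hp
    (by rwa [Equiv.Perm.mul_apply, ← hqp, Equiv.Perm.inv_def, Equiv.symm_apply_apply])
  exact (inv_mul_eq_one.1 h).symm

theorem image_permCoords_Omega0 (σ : Equiv.Perm (Fin 3)) : permCoords σ '' Omega0 = Omega0 := by
  have key : ∀ τ, permCoords τ '' Omega0 ⊆ Omega0 := by
    rintro τ _ ⟨_, ⟨q, hq, rfl⟩, rfl⟩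
    exact ⟨q ∘ τ.symm, fun i => hq _, rfl⟩
  refine (key σ).antisymm fun p hp => ⟨permCoords σ⁻¹ p, key _ ⟨p, hp, rfl⟩, ?_⟩
  simp

/-- Coordinate permutations preserve `Ω₀`, so the permutation factor of an element of `Γ` can be
dropped. -/
theorem Omega_eq_iUnion_Gamma2 : Omega = ⋃ γ ∈ Gamma2, γ '' Omega0 := by
  apply Set.Subset.antisymm
  · refine Set.iUnion₂_subset fun γ hγ => ?_
    obtain ⟨h, σ, hh, rfl⟩ := exists_isReducedWord_mul_perm hγ
    rw [Equiv.Perm.coe_mul, Set.image_comp, image_permCoords_Omega0]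
    exact Set.subset_biUnion_of_mem (u := fun γ : Equiv.Perm C3 => γ '' Omega0) hh.mem_Gamma2
  · exact Set.biUnion_mono Gamma2_le_Gamma fun _ _ => subset_rfl

theorem image_Omega {γ : Equiv.Perm C3} (hγ : γ ∈ Gamma) : γ '' Omega = Omega := by
  have key : ∀ δ ∈ Gamma, δ '' Omega ⊆ Omega := by
    rintro δ hδ _ ⟨p, hp, rfl⟩
    simp only [Omega, Set.mem_iUnion] at hp ⊢
    obtain ⟨η, hη, q, hq, rfl⟩ := hp
    exact ⟨δ * η, Gamma.mul_mem hδ hη, q, hq, rfl⟩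
  refine (key γ hγ).antisymm fun p hp => ⟨γ⁻¹ p, key _ (Gamma.inv_mem hγ) ⟨p, hp, rfl⟩, ?_⟩
  simp

theorem Omega_subset_realPoints : Omega ⊆ realPoints := by
  refine Set.iUnion₂_subset fun γ hγ => ?_
  rw [← image_realPoints hγ]
  exact Set.image_mono (Set.image_subset_range _ _)

theorem IsPolynomialMap.continuous {f : C3 → C3} (hf : IsPolynomialMap f) : Continuous f := by
  obtain ⟨P, hP⟩ := hf
  refine continuous_pi fun i => ?_
  simp only [hP]
  exact MvPolynomial.continuous_eval (P i)

theorem continuous_ofReal3 : Continuous ofReal3 :=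
  continuous_pi fun i => Complex.continuous_ofReal.comp (continuous_apply i)

theorem isOpen_preimage_image_Omega0 {γ : Equiv.Perm C3} (hγ : γ ∈ Gamma) :
    IsOpen (ofReal3 ⁻¹' (γ '' Omega0)) := by
  have hinv := Gamma.inv_mem hγ
  -- As `γ⁻¹` preserves `ℝ³`, membership amounts to three strict inequalities on real parts.
  have h : ofReal3 ⁻¹' (γ '' Omega0) = ⋂ i, {q | (γ⁻¹ (ofReal3 q) i).re < -2} := by
    ext q
    have hq : γ⁻¹ (ofReal3 q) ∈ realPoints := by
      rw [← image_realPoints hinv]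
      exact ⟨_, ⟨q, rfl⟩, rfl⟩
    obtain ⟨r, hr⟩ := hq
    have hγr : γ (ofReal3 r) = ofReal3 q := by rw [hr, Equiv.Perm.inv_def, Equiv.apply_symm_apply]
    rw [Set.mem_preimage, ← hγr, γ.injective.mem_set_image, Omega0,
      ofReal3_injective.mem_set_image, Set.mem_iInter]
    change _ ↔ ∀ i, (γ⁻¹ (ofReal3 q) i).re < -2
    rw [← hr]
    rfl
  rw [h]
  refine isOpen_iInter_of_finite fun i => isOpen_lt ?_ continuous_const
  exact Complex.continuous_re.comp
    ((continuous_apply i).comp (hinv.1.continuous.comp continuous_ofReal3))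

theorem isPreconnected_image_Omega0 {γ : Equiv.Perm C3} (hγ : γ ∈ Gamma) :
    IsPreconnected (γ '' Omega0) := by
  have h : IsPreconnected {q : Fin 3 → ℝ | ∀ i, q i < -2} := by
    have : {q : Fin 3 → ℝ | ∀ i, q i < -2} = Set.univ.pi fun _ => Set.Iio (-2) := by
      ext
      simp
    rw [this]
    exact (convex_pi fun _ _ => convex_Iio (-2)).isPreconnected
  exact (h.image _ continuous_ofReal3.continuousOn).image _ hγ.1.continuous.continuousOn

theorem isOpen_preimage_Omega : IsOpen (ofReal3 ⁻¹' Omega) := by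
  simp only [Omega, Set.preimage_iUnion]
  exact isOpen_biUnion fun γ hγ => isOpen_preimage_image_Omega0 hγ

theorem connectedComponentIn_Omega {γ : Equiv.Perm C3} (hγ : γ ∈ Gamma2) {p : C3}
    (hp : p ∈ γ '' Omega0) : connectedComponentIn Omega p = γ '' Omega0 := by
  have hsub : γ '' Omega0 ⊆ Omega := Set.subset_biUnion_of_mem
    (u := fun γ : Equiv.Perm C3 => γ '' Omega0) hγ.1
  refine Set.Subset.antisymm ?_
    ((isPreconnected_image_Omega0 hγ.1).subset_connectedComponentIn hp hsub)
  -- The translates are not open in `ℂ³`; pulling back along the real part gives open sets of `ℂ³`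
  -- with the same trace on `Ω`.
  set re : C3 → Fin 3 → ℝ := fun p i => (p i).re with hre
  have hcont : Continuous re :=
    continuous_pi fun i => Complex.continuous_re.comp (continuous_apply i)
  have hre_of : ∀ x ∈ Omega, ofReal3 (re x) = x := fun x hx => by
    obtain ⟨q, rfl⟩ := Omega_subset_realPoints hx
    rfl
  -- `V` collects all the other translates, so that `γΩ₀` and `V` separate `Ω`.
  set V : Set (Fin 3 → ℝ) := ⋃ δ ∈ {δ | δ ∈ Gamma2 ∧ γ ≠ δ}, ofReal3 ⁻¹' (δ '' Omega0) with hV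
  have hVopen : IsOpen V := isOpen_biUnion fun δ hδ => isOpen_preimage_image_Omega0 hδ.1.1
  have hdisj : Disjoint (ofReal3 ⁻¹' (γ '' Omega0)) V := by
    simp only [hV, Set.disjoint_iUnion_right]
    exact fun δ hδ => (disjoint_image_Omega0 hγ hδ.1 hδ.2).preimage _
  have hp' : p ∈ connectedComponentIn Omega p := mem_connectedComponentIn (hsub hp)
  have hle := isPreconnected_connectedComponentIn.subset_left_of_subset_union
    (s := connectedComponentIn Omega p)
    ((isOpen_preimage_image_Omega0 hγ.1).preimage hcont) (hVopen.preimage hcont)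
    (hdisj.preimage _) (fun x hx => ?_) ⟨p, hp', ?_⟩
  · intro x hx
    have := hle hx
    rwa [Set.mem_preimage, Set.mem_preimage,
      hre_of x (connectedComponentIn_subset _ _ hx)] at this
  · have hxΩ := connectedComponentIn_subset _ _ hx
    have hx' := hre_of x hxΩ
    rw [Omega_eq_iUnion_Gamma2] at hxΩ
    simp only [Set.mem_iUnion] at hxΩ
    obtain ⟨δ, hδ, hxδ⟩ := hxΩ
    by_cases hδγ : γ = δ
    · left
      rw [Set.mem_preimage, Set.mem_preimage, hx', hδγ]
      exact hxδ
    · right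
      refine Set.mem_biUnion (show δ ∈ {δ | δ ∈ Gamma2 ∧ γ ≠ δ} from ⟨hδ, hδγ⟩) ?_
      rw [Set.mem_preimage, hx']
      exact hxδ
  · rw [Set.mem_preimage, Set.mem_preimage, hre_of p (hsub hp)]
    exact hp

theorem Omega0_nonempty : Omega0.Nonempty :=
  ⟨_, fun _ => -3, fun _ => by norm_num, rfl⟩

theorem components_Omega : components Omega = {C | ∃ γ ∈ Gamma2, C = γ '' Omega0} := by
  ext C
  constructor
  · rintro ⟨p, hp, rfl⟩
    have hp' := hp
    rw [Omega_eq_iUnion_Gamma2] at hp'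
    simp only [Set.mem_iUnion] at hp'
    obtain ⟨γ, hγ, hpγ⟩ := hp'
    exact ⟨γ, hγ, connectedComponentIn_Omega hγ hpγ⟩
  · rintro ⟨γ, hγ, rfl⟩
    obtain ⟨p, hp⟩ := Omega0_nonempty.image γ
    refine ⟨p, ?_, (connectedComponentIn_Omega hγ hp).symm⟩
    exact Set.mem_biUnion (t := fun γ : Equiv.Perm C3 => γ '' Omega0) hγ.1 hp

theorem eq_one_of_image_eq {γ δ : Equiv.Perm C3} (hγ : γ ∈ Gamma2) (hδ : δ ∈ Gamma2)
    (h : γ '' (δ '' Omega0) = δ '' Omega0) : γ = 1 := by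
  by_contra hne
  have hd := disjoint_image_Omega0 (Gamma2.mul_mem hγ hδ) hδ (by simpa using hne)
  rw [Equiv.Perm.coe_mul, Set.image_comp, h, disjoint_self] at hd
  exact (Omega0_nonempty.image δ).ne_empty hd

end Fricke

end

theorem mainTheorem6 :
    -- `Γ` acts on `ℝ³`, and `Ω` is a `Γ`-invariant open subset of `ℝ³`
    (∀ γ ∈ Fricke.Gamma, γ '' Fricke.realPoints = Fricke.realPoints) ∧
    Fricke.Omega ⊆ Fricke.realPoints ∧
    IsOpen (Fricke.ofReal3 ⁻¹' Fricke.Omega) ∧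
    (∀ γ ∈ Fricke.Gamma, γ '' Fricke.Omega = Fricke.Omega) ∧
    -- `Ω` is the disjoint union of the translates `γΩ₀` over `γ ∈ Γ₍₂₎`
    Fricke.Omega = (⋃ γ ∈ Fricke.Gamma2, γ '' Fricke.Omega0) ∧
    (∀ γ ∈ Fricke.Gamma2, ∀ δ ∈ Fricke.Gamma2, γ ≠ δ →
      Disjoint (γ '' Fricke.Omega0) (δ '' Fricke.Omega0)) ∧
    -- `Γ₍₂₎` has index 6 in `Γ` and freely permutes the components of `Ω`, namely the `γΩ₀`
    Fricke.Gamma2 ≤ Fricke.Gamma ∧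
    Fricke.Gamma2.relIndex Fricke.Gamma = 6 ∧
    Fricke.components Fricke.Omega = {C | ∃ γ ∈ Fricke.Gamma2, C = γ '' Fricke.Omega0} ∧
    (∀ γ ∈ Fricke.Gamma2, ∀ C ∈ Fricke.components Fricke.Omega,
      γ '' C ∈ Fricke.components Fricke.Omega ∧ (γ '' C = C → γ = 1)) ∧
    -- only the trivial element of `Γ₍₂₎` carries some point of `Ω₀` into `Ω₀`
    (∀ γ ∈ Fricke.Gamma2, (∃ p ∈ Fricke.Omega0, γ p ∈ Fricke.Omega0) → γ = 1) := by
  refine ⟨fun γ hγ => Fricke.image_realPoints hγ, Fricke.Omega_subset_realPoints,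
    Fricke.isOpen_preimage_Omega, fun γ hγ => Fricke.image_Omega hγ,
    Fricke.Omega_eq_iUnion_Gamma2, fun γ hγ δ hδ => Fricke.disjoint_image_Omega0 hγ hδ,
    Fricke.Gamma2_le_Gamma, Fricke.relIndex_Gamma2, Fricke.components_Omega, ?_,
    fun γ hγ ⟨p, hp, hγp⟩ => Fricke.eq_one_of_mem_Omega0 hγ hp hγp⟩
  intro γ hγ C hC
  rw [Fricke.components_Omega] at hC ⊢
  obtain ⟨δ, hδ, rfl⟩ := hC
  refine ⟨⟨γ * δ, Fricke.Gamma2.mul_mem hγ hδ, ?_⟩, Fricke.eq_one_of_image_eq hγ hδ⟩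
  rw [Equiv.Perm.coe_mul, Set.image_comp]
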